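/- Let $(\Omega,\mathcal F,\mathbb P)$ be a complete probability space, $\emptyset\neq\Theta\subset\mathbb R^d$ a Borel set, and $\{p_\vartheta:\vartheta\in\Theta\}$ a family of probability densities on $(0,\infty)$, with distribution functions $P_\vartheta$, such that for each $\vartheta\in\Theta$: $p_\vartheta$ is positive and continuously differentiable on $(0,\infty)$, $\int_0^\infty |x|\,|p_\vartheta'(x)|\,dx<\infty$, $\sup_{x>0} p_\vartheta'(x)\min\{P_\vartheta(x),1-P_\vartheta(x)\}/p_\vartheta(x)^2<\infty$ and $\lim_{x\searrow 0}P_\vartheta(x)/p_\vartheta(x)=0$. Assume moreover that $\Theta\ni\vartheta\mapsto p_\vartheta'(x)/p_\vartheta(x)$ is continuous for every $x>0$. Let $1\le q<\infty$, let $w:(0,\infty)\to(0,\infty)$ be an integrable weight function, and let $\|f\|_{L^q}=\big(\int_0^\infty|f(t)|^q\,w(t)\,dt\big)^{1/q}$. Let $n\ge 1$, let $X_1,\dots,X_n$ be i.i.d. real random variables on $\Omega$ with density $p_{\vartheta_0}$ for some $\vartheta_0\in\Theta$, and for $t>0$, $\vartheta\in\Theta$ put $$\eta_n(\omega,t,\vartheta)=-\frac1n\sum_{j=1}^n\frac{p_\vartheta'(X_j(\omega))}{p_\vartheta(X_j(\omega))}\min\{X_j(\omega),t\}-\frac1n\sum_{j=1}^n\mathbf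 1\{X_j(\omega)\le t\},$$ where $p_\vartheta'/p_\vartheta$ is read as $0$ on $(-\infty,0]$ (a convention that concerns only a null event). Let $(\varepsilon_k)_{k\in\mathbb N}$ be (everywhere) positive random variables on $\Omega$ with $\varepsilon_k\to0$ almost surely. Define $$\psi_{n,q}(\omega,\vartheta)=\|\eta_n(\omega,\cdot,\vartheta)\|_{L^q},\quad m_{n,q}(\omega)=\inf_{\vartheta\in\Theta}\psi_{n,q}(\omega,\vartheta),\quad \Gamma_{n,q}(\omega)=\{\vartheta\in\Theta:\psi_{n,q}(\omega,\vartheta)\le m_{n,q}(\omega)+\varepsilon_n(\omega)\}.$$ Then: 1. $\psi_{n,q}(\omega,\vartheta)<\infty$ for all $(\omega,\vartheta)\in\Omega\times\Theta$, and $\psi_{n,q}$ is $\mathcal F\otimes\mathcal B(\Theta)$-measurable; 2. $m_{n,q}:\Omega\to\mathbb R$ is $\mathcal F$-measurable; 3. the graph $\{(\omega,\vartheta)\in\Omega\times\Theta:\vartheta\in\Gamma_{n,q}(\omega)\}$ belongs to $\mathcal F\otimes\mathcal B(\Theta)$, and for every $\omega\in\Omega$ the set $\Gamma_{n,q}(\omega)$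 is non-empty and closed in $\Theta$; 4. there is an $(\mathcal F,\mathcal B(\Theta))$-measurable map $\widehat\vartheta_{n,q}:\Omega\to\Theta$ with $\widehat\vartheta_{n,q}(\omega)\in\Gamma_{n,q}(\omega)$, that is, $$\big\|\eta_n(\omega,\cdot,\widehat\vartheta_{n,q}(\omega))\big\|_{L^q}\le\inf_{\vartheta\in\Theta}\|\eta_n(\omega,\cdot,\vartheta)\|_{L^q}+\varepsilon_n(\omega)\qquad\text{for every }\omega\in\Omega.$$ -/

import Mathlib

open MeasureTheory ProbabilityTheory Filter Topology Set

noncomputable section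

namespace SteinMDE

/-- The distribution function `x ↦ ∫₀ˣ f` (for `x > 0`) of a density `f` on `(0, ∞)`. -/
def cdfOf (f : ℝ → ℝ) (x : ℝ) : ℝ := ∫ y in Ioc 0 x, f y

/-- The assumptions on the family `p_θ` (`θ` in an index space `T`) of densities on `(0, ∞)`.
Only the values `p θ x` with `x > 0` matter. -/
structure IsSteinModel {T : Type*} [TopologicalSpace T] (p : T → ℝ → ℝ) : Prop where
  /-- each `p_θ` is positive on `(0, ∞)` -/
  pos : ∀ θ, ∀ x, 0 < x → 0 < p θ x
  /-- each `p_θ` is continuously differentiable on `(0, ∞)` -/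
  contDiffOn : ∀ θ, ContDiffOn ℝ 1 (p θ) (Ioi 0)
  /-- each `p_θ` is a probability density on `(0, ∞)` -/
  lintegral_eq_one : ∀ θ, ∫⁻ x in Ioi (0 : ℝ), ENNReal.ofReal (p θ x) = 1
  /-- `∫₀^∞ |x| |p_θ'(x)| dx < ∞` -/
  integrable_deriv : ∀ θ, IntegrableOn (fun x => |x| * |deriv (p θ) x|) (Ioi 0)
  /-- `sup_{x > 0} p_θ'(x) min {P_θ(x), 1 - P_θ(x)} / p_θ(x)² < ∞` -/
  bddAbove : ∀ θ, BddAbove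
    ((fun x => deriv (p θ) x * min (cdfOf (p θ) x) (1 - cdfOf (p θ) x) / (p θ x) ^ 2) '' Ioi 0)
  /-- `P_θ(x) / p_θ(x) → 0` as `x ↘ 0` -/
  tendsto_zero : ∀ θ, Tendsto (fun x => cdfOf (p θ) x / p θ x) (𝓝[>] 0) (𝓝 0)
  /-- `θ ↦ p_θ'(x) / p_θ(x)` is continuous for every `x > 0` -/
  continuous_score : ∀ x, 0 < x → Continuous fun θ => deriv (p θ) x / p θ x

open Classical in
/-- The function `p_θ' / p_θ` on `(0, ∞)`, set to `0` on `(-∞, 0]` (where the observations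
take values with probability zero only). -/
def score {T : Type*} (p : T → ℝ → ℝ) (θ : T) (x : ℝ) : ℝ :=
  if 0 < x then deriv (p θ) x / p θ x else 0

open Classical in
/-- `η_n(ω, t, θ) = -(1/n) ∑ⱼ (p_θ'(X_j)/p_θ(X_j)) min {X_j, t} - (1/n) ∑ⱼ 1{X_j ≤ t}`. -/
def eta {Ω T : Type*} {n : ℕ} (p : T → ℝ → ℝ) (X : Fin n → Ω → ℝ) (ω : Ω) (t : ℝ) (θ : T) : ℝ :=
  -(1 / (n : ℝ)) * ∑ j, score p θ (X j ω) * min (X j ω) t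
    - (1 / (n : ℝ)) * ∑ j, (if X j ω ≤ t then (1 : ℝ) else 0)

/-- `ψ_{n,q}(ω, θ) = (∫₀^∞ |η_n(ω, t, θ)|^q w(t) dt)^{1/q}`, the norm of `η_n(ω, ·, θ)` in
`L^q((0, ∞), w(t) dt)`. -/
def psi {Ω T : Type*} {n : ℕ} (q : ℝ) (w : ℝ → ℝ) (p : T → ℝ → ℝ) (X : Fin n → Ω → ℝ)
    (ω : Ω) (θ : T) : ℝ :=
  (∫ t in Ioi (0 : ℝ), |eta p X ω t θ| ^ q * w t) ^ (1 / q)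

/-- `m_{n,q}(ω) = inf_θ ψ_{n,q}(ω, θ)`. -/
def minValue {Ω T : Type*} {n : ℕ} (q : ℝ) (w : ℝ → ℝ) (p : T → ℝ → ℝ) (X : Fin n → Ω → ℝ)
    (ω : Ω) : ℝ :=
  ⨅ θ : T, psi q w p X ω θ

/-- `Γ_{n,q}(ω) = {θ | ψ_{n,q}(ω, θ) ≤ m_{n,q}(ω) + ε(ω)}`, the set of `ε`-approximate
minimizers. -/
def approxMinimizers {Ω T : Type*} {n : ℕ} (q : ℝ) (w : ℝ → ℝ) (p : T → ℝ → ℝ)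
    (X : Fin n → Ω → ℝ) (ε : Ω → ℝ) (ω : Ω) : Set T :=
  {θ | psi q w p X ω θ ≤ minValue q w p X ω + ε ω}

end SteinMDE

end

/-! Everything follows once `psi` is a Carathéodory function: measurable in `ω`, continuous in `θ`.
Measurability comes from integrating a jointly measurable function of `(ω, t)`; continuity from
dominated convergence, since the scores are continuous in `θ`, `eta` is bounded uniformly in `t >
0`, and `w` is integrable. By continuity a dense sequence already approaches the infimum, which
makes `minValue` measurable. As `ε n` is positive, some member of that sequence is always good
enough, and picking the first such index is a measurable choice. -/

namespace SteinMDE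

section Selection

variable {Ω T : Type*} [MeasurableSpace Ω] [TopologicalSpace T] [Nonempty T]
  [TopologicalSpace.SeparableSpace T] {f : Ω → T → ℝ}

/-- A continuous function takes a value below any bound exceeding its infimum on a dense
sequence. -/
theorem exists_denseSeq_lt {g : T → ℝ} (hg : Continuous g) {c : ℝ} (hc : ⨅ θ, g θ < c) :
    ∃ k, g (TopologicalSpace.denseSeq T k) < c := by
  obtain ⟨θ, hθ⟩ := exists_lt_of_ciInf_lt hc
  exact (TopologicalSpace.denseRange_denseSeq T).exists_mem_open
    (isOpen_lt hg continuous_const) ⟨θ, hθ⟩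

/-- The infimum of a Carathéodory function over a separable space is measurable. -/
theorem measurable_iInf_of_continuous (hm : ∀ θ, Measurable fun ω => f ω θ)
    (hc : ∀ ω, Continuous (f ω)) (hb : ∀ ω, BddBelow (range (f ω))) :
    Measurable fun ω => ⨅ θ, f ω θ := by
  refine measurable_of_Iio fun c => ?_
  have h : (fun ω => ⨅ θ, f ω θ) ⁻¹' Iio c
      = ⋃ k, {ω | f ω (TopologicalSpace.denseSeq T k) < c} := by
    ext ω
    simp only [mem_preimage, mem_Iio, mem_iUnion, mem_ofPred_eq]
    exact ⟨exists_denseSeq_lt (hc ω), fun ⟨k, hk⟩ => (ciInf_le (hb ω) _).trans_lt hk⟩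
  rw [h]
  exact MeasurableSet.iUnion fun k => measurableSet_lt (hm _) measurable_const

/-- A Carathéodory function is jointly measurable. -/
theorem measurable_prod_of_continuous {Ω T : Type*} [MeasurableSpace Ω] [TopologicalSpace T]
    [TopologicalSpace.MetrizableSpace T] [SecondCountableTopology T] [MeasurableSpace T]
    [OpensMeasurableSpace T] {f : Ω → T → ℝ} (hm : ∀ θ, Measurable fun ω => f ω θ)
    (hc : ∀ ω, Continuous (f ω)) : Measurable fun z : Ω × T => f z.1 z.2 :=
  (measurable_uncurry_of_continuous_of_measurable (u := fun θ ω => f ω θ) hc hm).comp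
    measurable_swap

/-- Measurable selection of approximate minimizers of a Carathéodory function: take the first
element of a dense sequence that is good enough. -/
theorem exists_measurable_approx_minimizer [MeasurableSpace T]
    (hm : ∀ θ, Measurable fun ω => f ω θ) (hc : ∀ ω, Continuous (f ω))
    (hb : ∀ ω, BddBelow (range (f ω))) {e : Ω → ℝ} (he : Measurable e) (he_pos : ∀ ω, 0 < e ω) :
    ∃ s : Ω → T, Measurable s ∧ ∀ ω, f ω (s ω) ≤ (⨅ θ, f ω θ) + e ω := by
  classical
  have hex : ∀ ω, ∃ k, f ω (TopologicalSpace.denseSeq T k) < (⨅ θ, f ω θ) + e ω := fun ω =>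
    exists_denseSeq_lt (hc ω) (lt_add_of_pos_right _ (he_pos ω))
  refine ⟨fun ω => TopologicalSpace.denseSeq T (Nat.find (hex ω)), ?_, fun ω =>
    (Nat.find_spec (hex ω)).le⟩
  -- The selector factors through the discrete space `ℕ`, so only the first good index has to be
  -- measurable.
  exact measurable_from_nat.comp (measurable_find hex fun k =>
    measurableSet_lt (hm _) ((measurable_iInf_of_continuous hm hc hb).add he))

end Selection

variable {T : Type*} {p : T → ℝ → ℝ}

theorem score_of_nonpos {θ : T} {x : ℝ} (hx : x ≤ 0) : score p θ x = 0 :=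
  if_neg hx.not_gt

theorem IsSteinModel.measurable_score [TopologicalSpace T] (hp : IsSteinModel p) (θ : T) :
    Measurable (score p θ) := by
  classical
  -- `p θ` is controlled only on `(0, ∞)`, so it is cut off before dividing; `deriv` is measurable
  -- for every function.
  have h1 : Measurable ((Ioi (0 : ℝ)).piecewise (p θ) 0) :=
    (hp.contDiffOn θ).continuousOn.measurable_piecewise continuousOn_const measurableSet_Ioi
  have h2 : score p θ
      = (Ioi (0 : ℝ)).piecewise (deriv (p θ) / (Ioi (0 : ℝ)).piecewise (p θ) 0) 0 := by
    funext x
    by_cases hx : 0 < x <;> simp [score, hx]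
  rw [h2]
  exact ((measurable_deriv _).div h1).piecewise measurableSet_Ioi measurable_zero

theorem IsSteinModel.continuous_score_apply [TopologicalSpace T] (hp : IsSteinModel p) (x : ℝ) :
    Continuous fun θ => score p θ x := by
  by_cases hx : 0 < x
  · simpa only [score, if_pos hx] using hp.continuous_score x hx
  · simpa only [score, if_neg hx] using continuous_const

variable {Ω : Type*} {n : ℕ} {X : Fin n → Ω → ℝ}

/-- A bound of `η_n(ω, t, θ)` that does not depend on `t > 0`. -/
noncomputable def etaBound (p : T → ℝ → ℝ) (X : Fin n → Ω → ℝ) (ω : Ω) (θ : T) : ℝ :=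
  1 / (n : ℝ) * ∑ j, |score p θ (X j ω)| * |X j ω| + 1 / (n : ℝ) * ∑ _j : Fin n, 1

/-- For `X j ω > 0` the minimum lies between `0` and `X j ω`; otherwise the score vanishes. -/
theorem abs_eta_le_etaBound (ω : Ω) {t : ℝ} (ht : 0 < t) (θ : T) :
    |eta p X ω t θ| ≤ etaBound p X ω θ := by
  have hn : (0 : ℝ) ≤ 1 / n := by positivity
  refine (abs_sub _ _).trans (add_le_add ?_ ?_)
  · rw [abs_mul, abs_neg, abs_of_nonneg hn]
    refine mul_le_mul_of_nonneg_left ((Finset.abs_sum_le_sum_abs _ _).trans ?_) hn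
    refine Finset.sum_le_sum fun j _ => ?_
    rw [abs_mul]
    rcases le_or_gt (X j ω) 0 with hx | hx
    · simp [score_of_nonpos hx]
    · refine mul_le_mul_of_nonneg_left ?_ (abs_nonneg _)
      rw [abs_of_pos (lt_min hx ht), abs_of_pos hx]
      exact min_le_left _ _
  · rw [abs_mul, abs_of_nonneg hn]
    refine mul_le_mul_of_nonneg_left ((Finset.abs_sum_le_sum_abs _ _).trans ?_) hn
    refine Finset.sum_le_sum fun j _ => ?_
    split_ifs <;> simp

theorem IsSteinModel.continuous_etaBound [TopologicalSpace T] (hp : IsSteinModel p) (ω : Ω) :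
    Continuous (etaBound p X ω) := by
  have h := fun j => hp.continuous_score_apply (X j ω)
  unfold etaBound
  fun_prop

theorem IsSteinModel.continuous_eta [TopologicalSpace T] (hp : IsSteinModel p) (ω : Ω) (t : ℝ) :
    Continuous (eta p X ω t) := by
  have h := fun j => hp.continuous_score_apply (X j ω)
  unfold eta
  fun_prop

theorem measurable_eta_right (ω : Ω) (θ : T) : Measurable fun t => eta p X ω t θ := by
  unfold eta
  refine .sub (.const_mul (Finset.measurable_sum _ fun j _ => by fun_prop) _)
    (.const_mul (Finset.measurable_sum _ fun j _ => ?_) _)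
  exact .ite (measurableSet_le measurable_const measurable_id) measurable_const measurable_const

theorem IsSteinModel.measurable_eta [TopologicalSpace T] [MeasurableSpace Ω] (hp : IsSteinModel p)
    (hX : ∀ j, Measurable (X j)) (θ : T) : Measurable fun z : Ω × ℝ => eta p X z.1 z.2 θ := by
  have hs := hp.measurable_score θ
  unfold eta
  refine .sub (.const_mul (Finset.measurable_sum _ fun j _ => by fun_prop) _)
    (.const_mul (Finset.measurable_sum _ fun j _ => ?_) _)
  exact .ite (measurableSet_le ((hX j).comp measurable_fst) measurable_snd)
    measurable_const measurable_const

variable {q : ℝ} {w : ℝ → ℝ}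

theorem aestronglyMeasurable_eta_rpow_mul (hw_int : IntegrableOn w (Ioi 0)) (ω : Ω) (θ : T) :
    AEStronglyMeasurable (fun t => |eta p X ω t θ| ^ q * w t) (volume.restrict (Ioi 0)) := by
  refine AEStronglyMeasurable.mul (Measurable.aestronglyMeasurable ?_) hw_int.1
  exact (continuous_abs.measurable.comp (measurable_eta_right ω θ)).pow_const q

theorem norm_eta_rpow_mul_le (hq : 0 ≤ q) (hw_pos : ∀ t, 0 < t → 0 < w t) (ω : Ω) {θ : T} {C : ℝ}
    (hC : etaBound p X ω θ ≤ C) :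
    ∀ᵐ t ∂volume.restrict (Ioi 0), ‖|eta p X ω t θ| ^ q * w t‖ ≤ C ^ q * w t := by
  filter_upwards [ae_restrict_mem measurableSet_Ioi] with t ht
  have hw := (hw_pos t ht).le
  rw [Real.norm_of_nonneg (by positivity)]
  gcongr
  exact (abs_eta_le_etaBound ω ht θ).trans hC

theorem integrableOn_eta_rpow_mul (hq : 0 ≤ q) (hw_pos : ∀ t, 0 < t → 0 < w t)
    (hw_int : IntegrableOn w (Ioi 0)) (ω : Ω) (θ : T) :
    IntegrableOn (fun t => |eta p X ω t θ| ^ q * w t) (Ioi 0) :=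
  Integrable.mono' (hw_int.const_mul _) (aestronglyMeasurable_eta_rpow_mul hw_int ω θ)
    (norm_eta_rpow_mul_le hq hw_pos ω le_rfl)

theorem IsSteinModel.continuous_psi [TopologicalSpace T] [FirstCountableTopology T] (hp : IsSteinModel p) (hq : 0 ≤ q)
    (hw_pos : ∀ t, 0 < t → 0 < w t) (hw_int : IntegrableOn w (Ioi 0)) (ω : Ω) :
    Continuous (psi q w p X ω) := by
  -- Since `1 / q ≥ 0`, the outer root is continuous even where the integral is zero.
  refine Continuous.rpow_const ?_ fun _ => Or.inr (by positivity)
  refine continuous_iff_continuousAt.2 fun θ => continuousAt_of_dominated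
    -- `etaBound` is continuous in `θ`, so near `θ` it stays below its value there plus one.
    (bound := fun t => (etaBound p X ω θ + 1) ^ q * w t)
    (.of_forall fun θ' => aestronglyMeasurable_eta_rpow_mul hw_int ω θ') ?_
    (hw_int.const_mul _) (.of_forall fun t => ?_)
  · filter_upwards [(hp.continuous_etaBound (X := X) ω).continuousAt.eventually_lt
      continuousAt_const (lt_add_one (etaBound p X ω θ))] with θ' hθ'
    exact norm_eta_rpow_mul_le hq hw_pos ω hθ'.le
  · exact (((hp.continuous_eta ω t).abs.rpow_const fun _ => Or.inr hq).mul
      continuous_const).continuousAt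

theorem IsSteinModel.measurable_psi_left [TopologicalSpace T] [MeasurableSpace Ω] (hp : IsSteinModel p)
    (hX : ∀ j, Measurable (X j)) (hw_int : IntegrableOn w (Ioi 0)) (θ : T) :
    Measurable fun ω => psi q w p X ω θ := by
  unfold psi
  -- `w` is only a.e. strongly measurable; a measurable version gives joint measurability in `(ω,
  -- t)` without changing the integral.
  have h : ∀ ω, ∫ t in Ioi (0 : ℝ), |eta p X ω t θ| ^ q * w t
      = ∫ t in Ioi (0 : ℝ), |eta p X ω t θ| ^ q * hw_int.1.mk w t := fun ω => by
    refine integral_congr_ae ?_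
    filter_upwards [hw_int.1.ae_eq_mk] with t ht
    rw [ht]
  simp_rw [h]
  have hm : Measurable fun z : Ω × ℝ => |eta p X z.1 z.2 θ| ^ q * hw_int.1.mk w z.2 :=
    ((continuous_abs.measurable.comp (hp.measurable_eta hX θ)).pow_const q).mul
      (hw_int.1.stronglyMeasurable_mk.measurable.comp measurable_snd)
  exact (hm.stronglyMeasurable.integral_prod_right
    (ν := volume.restrict (Ioi (0 : ℝ)))).measurable.pow_const _

theorem psi_nonneg (hw_pos : ∀ t, 0 < t → 0 < w t) (ω : Ω) (θ : T) : 0 ≤ psi q w p X ω θ :=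
  Real.rpow_nonneg (setIntegral_nonneg measurableSet_Ioi fun t ht =>
    mul_nonneg (by positivity) (hw_pos t ht).le) _

end SteinMDE

theorem mainTheorem3
    {Ω : Type*} [MeasurableSpace Ω] (P : Measure Ω) [IsProbabilityMeasure P] [P.IsComplete]
    (d : ℕ) (Θ : Set (EuclideanSpace ℝ (Fin d))) (hΘ : MeasurableSet Θ)
    (p : Θ → ℝ → ℝ) (hp : SteinMDE.IsSteinModel p) (θ₀ : Θ)
    (q : ℝ) (hq : 1 ≤ q)
    (w : ℝ → ℝ) (hw_pos : ∀ t, 0 < t → 0 < w t) (hw_int : IntegrableOn w (Ioi 0))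
    (n : ℕ) (hn : 1 ≤ n)
    (X : Fin n → Ω → ℝ) (hX_meas : ∀ j, Measurable (X j)) (hX_indep : iIndepFun X P)
    (hX_law : ∀ j, P.map (X j) =
      (volume.restrict (Ioi (0 : ℝ))).withDensity (fun x => ENNReal.ofReal (p θ₀ x)))
    (ε : ℕ → Ω → ℝ) (hε_meas : ∀ k, Measurable (ε k)) (hε_pos : ∀ k ω, 0 < ε k ω)
    (hε_lim : ∀ᵐ ω ∂P, Tendsto (fun k => ε k ω) atTop (𝓝 0)) :
    (∀ ω θ, IntegrableOn (fun t => |SteinMDE.eta p X ω t θ| ^ q * w t) (Ioi 0)) ∧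
    Measurable (fun z : Ω × Θ => SteinMDE.psi q w p X z.1 z.2) ∧
    Measurable (SteinMDE.minValue q w p X) ∧
    MeasurableSet {z : Ω × Θ | z.2 ∈ SteinMDE.approxMinimizers q w p X (ε n) z.1} ∧
    (∀ ω, (SteinMDE.approxMinimizers q w p X (ε n) ω).Nonempty ∧
      IsClosed (SteinMDE.approxMinimizers q w p X (ε n) ω)) ∧
    ∃ θhat : Ω → Θ, Measurable θhat ∧
      (∀ ω, θhat ω ∈ SteinMDE.approxMinimizers q w p X (ε n) ω) ∧
      ∀ ω, SteinMDE.psi q w p X ω (θhat ω) ≤ (⨅ θ : Θ, SteinMDE.psi q w p X ω θ) + ε n ω := by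
  have : Nonempty Θ := ⟨θ₀⟩
  have hq0 : 0 ≤ q := zero_le_one.trans hq
  have hc : ∀ ω, Continuous (SteinMDE.psi q w p X ω) := hp.continuous_psi hq0 hw_pos hw_int
  have hm : ∀ θ, Measurable fun ω => SteinMDE.psi q w p X ω θ :=
    hp.measurable_psi_left hX_meas hw_int
  have hb : ∀ ω, BddBelow (range (SteinMDE.psi q w p X ω)) := fun ω =>
    ⟨0, forall_mem_range.2 fun θ => SteinMDE.psi_nonneg hw_pos ω θ⟩
  have hψ : Measurable fun z : Ω × Θ => SteinMDE.psi q w p X z.1 z.2 :=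
    SteinMDE.measurable_prod_of_continuous hm hc
  have hmin : Measurable (SteinMDE.minValue q w p X) :=
    SteinMDE.measurable_iInf_of_continuous hm hc hb
  obtain ⟨s, hs, hsel⟩ :=
    SteinMDE.exists_measurable_approx_minimizer hm hc hb (hε_meas n) (hε_pos n)
  exact ⟨fun ω θ => SteinMDE.integrableOn_eta_rpow_mul hq0 hw_pos hw_int ω θ, hψ, hmin,
    measurableSet_le hψ ((hmin.add (hε_meas n)).comp measurable_fst),
    fun ω => ⟨⟨s ω, hsel ω⟩, isClosed_le (hc ω) continuous_const⟩, s, hs, hsel, hsel⟩
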